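/- Let $\mathcal S$ be the set of all sequences $\alpha=(\alpha_i)_{i\in\mathbb N}$ of real numbers with $1\ge\alpha_1\ge\alpha_2\ge\dots\ge 0$ and $\lim_i\alpha_i=0$. Let $\mathbf R,\mathbf C\subset B(\ell_2)$ be the row and column operator spaces, that is, the closed linear spans of the matrix units $(E_{1j})_{j\in\mathbb N}$ and $(E_{i1})_{i\in\mathbb N}$ respectively, and let $\mathbf R\oplus\mathbf C\subset B(\ell_2\oplus_2\ell_2)$ be their direct sum. For $\alpha\in\mathcal S$, let $X^d(\alpha)\subset\mathbf R\oplus\mathbf C$ be the closed linear span of the vectors $e_i(\alpha)=E_{1i}\oplus\alpha_iE_{i1}$ ($i\in\mathbb N$), called the canonical basis of $X^d(\alpha)$; equivalently, $$X^d(\alpha)=\Big\{\Big(\sum_j x_jE_{1j}\Big)\oplus\Big(\sum_i\alpha_ix_iE_{i1}\Big):x\in\ell_2\Big\}.$$ For a linear map $u:X\to Y$ between operator spaces, $\|u\|_{cb}=\sup_n\|I_{M_n}\otimes u:M_n(X)\to M_n(Y)\|$, where for $X\subset B(H)$ the norm on $M_n(X)$ is that inherited from $B(\ell_2^n\otimes_2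 H)$. **Theorem.** Let $\alpha,\beta\in\mathcal S$ and $C\ge 0$, and suppose that there is an isomorphism $U:X^d(\alpha)\to X^d(\beta)$ with $\|U\|_{cb}\le C$ and $\|U^{-1}\|_{cb}\le C$. Then the formal identity $id:X^d(\alpha)\to X^d(\beta)$, i.e. the bounded linear bijection which maps $e_i(\alpha)$ to $e_i(\beta)$ for every $i\in\mathbb N$, satisfies $\|id\|_{cb}<4C^2$ and $\|id^{-1}\|_{cb}<4C^2$. -/

import Mathlib

open scoped ENNReal NNReal

noncomputable section

namespace OpSp

/-! ### Concrete operator spaces and completely bounded norms -/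

section General

variable {H K : Type*} [NormedAddCommGroup H] [InnerProductSpace ℂ H]
  [NormedAddCommGroup K] [InnerProductSpace ℂ K]

/-- The bounded operator on the Hilbert space `H ⊕₂ ⋯ ⊕₂ H` (`n` summands, i.e. `ℓ₂ⁿ ⊗₂ H`)
given by an `n × n` matrix of bounded operators on `H`:
`(matOp a v) i = ∑ j, a i j (v j)`. -/
def matOp {n : ℕ} (a : Matrix (Fin n) (Fin n) (H →L[ℂ] H)) :
    PiLp 2 (fun _ : Fin n => H) →L[ℂ] PiLp 2 (fun _ : Fin n => H) :=
  ((PiLp.continuousLinearEquiv 2 ℂ (fun _ : Fin n => H)).symm :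
      (Fin n → H) →L[ℂ] PiLp 2 (fun _ : Fin n => H)) ∘L
    ContinuousLinearMap.pi fun i =>
      ∑ j, a i j ∘L (PiLp.proj 2 (fun _ : Fin n => H) j : PiLp 2 (fun _ : Fin n => H) →L[ℂ] H)

theorem matOp_apply {n : ℕ} (a : Matrix (Fin n) (Fin n) (H →L[ℂ] H))
    (v : PiLp 2 (fun _ : Fin n => H)) (i : Fin n) :
    matOp a v i = ∑ j, a i j (v j) := by
  simp [matOp]

/-- The norm of `M_n(X)`, for a space `X` of operators on `H`: the norm of `x ∈ M_n(X)` as an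
operator on `ℓ₂ⁿ ⊗₂ H`. -/
def matNorm (X : Submodule ℂ (H →L[ℂ] H)) {n : ℕ} (x : Matrix (Fin n) (Fin n) X) : ℝ :=
  ‖matOp (x.map (fun y : X => (y : H →L[ℂ] H)))‖

/-- The completely bounded norm `sup_n ‖I_{M_n} ⊗ u : M_n(X) → M_n(Y)‖` of a linear map between
operator spaces `X ⊆ B(H)` and `Y ⊆ B(K)`, with value `∞` if `u` is not completely bounded. -/
def cbNorm {X : Submodule ℂ (H →L[ℂ] H)} {Y : Submodule ℂ (K →L[ℂ] K)} (u : X →ₗ[ℂ] Y) : ℝ≥0∞ :=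
  ⨆ (n : ℕ) (x : Matrix (Fin n) (Fin n) X) (_ : matNorm X x ≤ 1),
    ENNReal.ofReal (matNorm Y (x.map u))

/-- The operator `S ⊕ T` on `H ⊕₂ K`. -/
def dirSum (S : H →L[ℂ] H) (T : K →L[ℂ] K) : WithLp 2 (H × K) →L[ℂ] WithLp 2 (H × K) :=
  ((WithLp.prodContinuousLinearEquiv 2 ℂ H K).symm : H × K →L[ℂ] WithLp 2 (H × K)) ∘L
    (S.prodMap T) ∘L (WithLp.prodContinuousLinearEquiv 2 ℂ H K : WithLp 2 (H × K) →L[ℂ] H × K)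

theorem dirSum_apply (S : H →L[ℂ] H) (T : K →L[ℂ] K) (v : WithLp 2 (H × K)) :
    dirSum S T v = WithLp.toLp 2 (S v.fst, T v.snd) := rfl

theorem norm_le_norm_dirSum (S : H →L[ℂ] H) (T : K →L[ℂ] K) : ‖S‖ ≤ ‖dirSum S T‖ := by
  refine S.opNorm_le_bound (norm_nonneg (dirSum S T)) fun h => ?_
  have := (dirSum S T).le_opNorm (WithLp.toLp 2 (h, 0))
  simpa [dirSum_apply] using this

theorem norm_dirSum_le (S : H →L[ℂ] H) (T : K →L[ℂ] K) : ‖dirSum S T‖ ≤ ‖S‖ + ‖T‖ := by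
  refine (dirSum S T).opNorm_le_bound (add_nonneg (norm_nonneg S) (norm_nonneg T)) fun v => ?_
  have h : dirSum S T v = WithLp.toLp 2 (S v.fst, 0) + WithLp.toLp 2 (0, T v.snd) := by
    rw [dirSum_apply, ← WithLp.toLp_add, Prod.mk_add_mk, add_zero, zero_add]
  have h₁ : ‖v.fst‖ ≤ ‖v‖ := WithLp.norm_fst_le _ v
  have h₂ : ‖v.snd‖ ≤ ‖v‖ := WithLp.norm_snd_le _ v
  rw [h, add_mul]
  refine (norm_add_le _ _).trans (add_le_add ?_ ?_)
  · rw [WithLp.norm_toLp_fst]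
    exact (S.le_opNorm _).trans (by gcongr)
  · rw [WithLp.norm_toLp_snd]
    exact (T.le_opNorm _).trans (by gcongr)

end General

/-! ### The spaces `X(A)` and `X^d(α)` -/

/-- The complex Hilbert space `ℓ₂`. -/
abbrev L2 : Type := lp (fun _ : ℕ => ℂ) 2

/-- The canonical orthonormal basis `ξ_i` of `ℓ₂`. -/
def xi (i : ℕ) : L2 := lp.single 2 i 1

theorem norm_xi (i : ℕ) : ‖xi i‖ = 1 := by
  simp [xi, lp.norm_single]

/-- The element `∑ j, x_j E_{0j}` of the row space `R = span {E_{0j}} ⊆ B(ℓ₂)`, where `E_{ij}` are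
the matrix units: the operator `ζ ↦ (∑ j, x_j ζ_j) ξ_0`. It is linear in `x`. -/
def rowOp (x : L2) : L2 →L[ℂ] L2 := InnerProductSpace.rankOne ℂ (xi 0) (star x)

/-- The element `∑ i, y_i E_{i0}` of the column space `C = span {E_{i0}} ⊆ B(ℓ₂)`: the operator
`ζ ↦ ζ_0 y`. -/
def colOp (y : L2) : L2 →L[ℂ] L2 := InnerProductSpace.rankOne ℂ y (xi 0)

/-- The map `x ↦ (x, A x) ∈ R ⊕ C ⊆ B(ℓ₂ ⊕₂ ℓ₂)`. -/
def embed (A : L2 →L[ℂ] L2) : L2 →ₗ[ℂ] (WithLp 2 (L2 × L2) →L[ℂ] WithLp 2 (L2 × L2)) where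
  toFun x := dirSum (rowOp x) (colOp (A x))
  map_add' x y := by
    ext v : 1
    simp only [dirSum_apply, rowOp, colOp, InnerProductSpace.rankOne_apply, star_add, map_add, add_apply]
    rw [← WithLp.toLp_add, Prod.mk_add_mk]
  map_smul' c x := by
    ext v : 1
    simp only [dirSum_apply, rowOp, colOp, InnerProductSpace.rankOne_apply, star_smul, map_smul,
      inner_smul_left, RingHom.id_apply, smul_apply]
    rw [← WithLp.toLp_smul, Prod.smul_mk, smul_smul]
    simp [smul_smul]

theorem norm_le_norm_embed (A : L2 →L[ℂ] L2) (x : L2) : ‖x‖ ≤ ‖embed A x‖ := by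
  refine le_trans (le_of_eq ?_) (norm_le_norm_dirSum (rowOp x) (colOp (A x)))
  simp [rowOp, norm_xi]

theorem embed_injective (A : L2 →L[ℂ] L2) : Function.Injective (embed A) := by
  rw [injective_iff_map_eq_zero]
  intro x hx
  have := norm_le_norm_embed A x
  rw [hx, norm_zero] at this
  exact norm_le_zero_iff.mp this

/-- The operator space `X(A) = {(x, A x) : x ∈ ℓ₂} ⊆ R ⊕ C ⊆ B(ℓ₂ ⊕₂ ℓ₂)`. -/
def XA (A : L2 →L[ℂ] L2) : Submodule ℂ (WithLp 2 (L2 × L2) →L[ℂ] WithLp 2 (L2 × L2)) :=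
  LinearMap.range (embed A)

theorem isClosed_XA (A : L2 →L[ℂ] L2) :
    IsClosed (XA A : Set (WithLp 2 (L2 × L2) →L[ℂ] WithLp 2 (L2 × L2))) := by
  have hb : ∀ x, ‖embed A x‖ ≤ (1 + ‖A‖) * ‖x‖ := fun x => by
    refine (norm_dirSum_le (rowOp x) (colOp (A x))).trans ?_
    have := A.le_opNorm x
    simp only [rowOp, colOp, InnerProductSpace.norm_rankOne, norm_xi, norm_star]
    linarith
  have hu : UniformContinuous (embed A) :=
    ((embed A).mkContinuous _ hb).uniformContinuous
  have ha : AntilipschitzWith 1 (embed A) :=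
    AddMonoidHomClass.antilipschitz_of_bound (embed A) fun x => by
      simpa using norm_le_norm_embed A x
  rw [XA, LinearMap.coe_range]
  exact ha.isClosed_range hu

/-- The linear bijection `x ↦ (x, A x)` from `ℓ₂` onto `X(A)`. -/
def toX (A : L2 →L[ℂ] L2) : L2 ≃ₗ[ℂ] XA A := LinearEquiv.ofInjective (embed A) (embed_injective A)

theorem memℓp_diag (α : ℕ → unitInterval) (x : L2) :
    Memℓp (fun i => ((α i : ℝ) : ℂ) * x i) 2 := by
  refine (lp.memℓp x).mono' fun i => ?_
  rw [norm_mul, Complex.norm_real, Real.norm_of_nonneg (α i).2.1]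
  exact mul_le_of_le_one_left (norm_nonneg _) (α i).2.2

/-- The diagonal operator `diag(α)` on `ℓ₂`, for a sequence `α` in `[0, 1]`. -/
def diag (α : ℕ → unitInterval) : L2 →L[ℂ] L2 :=
  LinearMap.mkContinuous
    { toFun := fun x => ⟨fun i => ((α i : ℝ) : ℂ) * x i, memℓp_diag α x⟩
      map_add' := fun x y => lp.ext (funext fun i => mul_add _ (x i) (y i))
      map_smul' := fun c x => lp.ext (funext fun i => mul_left_comm _ c (x i)) }
    1 (fun x => by
      rw [one_mul]
      refine lp.norm_mono two_ne_zero fun i => ?_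
      change ‖((α i : ℝ) : ℂ) * x i‖ ≤ _
      rw [norm_mul, Complex.norm_real, Real.norm_of_nonneg (α i).2.1]
      exact mul_le_of_le_one_left (norm_nonneg _) (α i).2.2)

theorem diag_apply (α : ℕ → unitInterval) (x : L2) (i : ℕ) :
    diag α x i = ((α i : ℝ) : ℂ) * x i := rfl

/-- The operator space `X^d(α) = X(diag(α))`. -/
abbrev Xd (α : ℕ → unitInterval) :
    Submodule ℂ (WithLp 2 (L2 × L2) →L[ℂ] WithLp 2 (L2 × L2)) :=
  XA (diag α)

/-- The canonical basis `e_i(α) = ξ_i ⊕ α_i ξ_i` of `X^d(α)`. -/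
def basisVec (α : ℕ → unitInterval) (i : ℕ) : Xd α := toX (diag α) (xi i)

theorem coe_basisVec (α : ℕ → unitInterval) (i : ℕ) :
    (basisVec α i : WithLp 2 (L2 × L2) →L[ℂ] WithLp 2 (L2 × L2)) =
      dirSum (rowOp (xi i)) (colOp (((α i : ℝ) : ℂ) • xi i)) := by
  have h : diag α (xi i) = ((α i : ℝ) : ℂ) • xi i := by
    refine lp.ext (funext fun j => ?_)
    rw [diag_apply]
    rcases eq_or_ne j i with rfl | hj
    · rfl
    · rw [lp.coeFn_smul, Pi.smul_apply, xi, lp.single_apply_ne _ _ _ hj]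
      simp
  rw [← h]
  rfl

/-- The formal identity `X^d(α) → X^d(β)`, that is
`(x, diag(α) x) ↦ (x, diag(β) x)` for `x ∈ ℓ₂`. -/
def formalId (α β : ℕ → unitInterval) : Xd α ≃ₗ[ℂ] Xd β :=
  (toX (diag α)).symm.trans (toX (diag β))

theorem formalId_basisVec (α β : ℕ → unitInterval) (i : ℕ) :
    formalId α β (basisVec α i) = basisVec β i := by
  simp [formalId, basisVec]

/-- The set `𝒮` of non-increasing sequences in `[0, 1]` which converge to `0`. -/
def seqS : Set (ℕ → unitInterval) :=
  {α | Antitone α ∧ Filter.Tendsto α Filter.atTop (nhds 0)}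

end OpSp

end

open OpSp

/-!
The norm of a matrix over `X(A)` is the maximum of its row norm and of the column norm of its image
under `A`, and for a matrix with a single column the latter is a Hilbert–Schmidt norm. Suppose that
`u : X^d(α) → X^d(β)` and `v` satisfy `u ∘ v = id`, `‖u‖_cb ≤ C` and `‖v‖_cb ≤ D`. Applying this to
the column `(v w_i)_i` for an orthonormal family `w` gives
`∑ ‖diag(β) w_i‖² ≤ C² (D² + ∑ ‖diag(α) v w_i‖²)`.
Hence, on the span of the first `n` basis vectors, the positive part of `P - Q` has trace at most
`(C D)²`, where `P` and `Q` are the Gram operators of `diag(β)` and `C diag(α) v`. As `P` and `Q`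
are both at most `Q + (P - Q)₊`, monotonicity of eigenvalues bounds `∑ (λ_k(P) - λ_k(Q))₊` by the
same number, and since `α` and `β` decrease, the minimax principle yields
`∑ (β_k² - (C D)² α_k²)₊ ≤ (C D)²`.
This is what the column part of the formal identity costs: the excess of `β_k²` over `(C D)² α_k²`
is summable, and each single coordinate is controlled by the row norm. The row part does not change.
-/

namespace OpSp

section Eigenvalues

variable {𝕜 E : Type*} [RCLike 𝕜] [NormedAddCommGroup E] [InnerProductSpace 𝕜 E]

theorem exists_mem_ne_zero_forall_inner_eq_zero {ι : Type*} [Fintype ι] (v : ι → E)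
    {S : Submodule 𝕜 E} (hS : Fintype.card ι < Module.finrank 𝕜 S) :
    ∃ x ∈ S, x ≠ 0 ∧ ∀ i, inner 𝕜 (v i) x = 0 := by
  have : FiniteDimensional 𝕜 S := Module.finite_of_finrank_pos (Nat.zero_lt_of_lt hS)
  let φ : S →ₗ[𝕜] ι → 𝕜 := LinearMap.pi fun i => innerₛₗ 𝕜 (v i) ∘ₗ S.subtype
  have hφ : φ.ker ≠ ⊥ := LinearMap.ker_ne_bot_of_finrank_lt (by simpa using hS)
  obtain ⟨x, hx, hx₀⟩ := (Submodule.ne_bot_iff _).1 hφ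
  exact ⟨x, x.2, by simpa using hx₀, congr_fun (LinearMap.mem_ker.1 hx)⟩

variable [FiniteDimensional 𝕜 E] {n : ℕ} (hn : Module.finrank 𝕜 E = n)
variable {T P Q D : E →ₗ[𝕜] E} (hT : T.IsSymmetric) (hP : P.IsSymmetric) (hQ : Q.IsSymmetric)

theorem re_inner_apply_self_eq_sum_eigenvalues (x : E) :
    RCLike.re (inner 𝕜 (T x) x) =
      ∑ j, hT.eigenvalues hn j * ‖inner 𝕜 (hT.eigenvectorBasis hn j) x‖ ^ 2 := by
  rw [← (hT.eigenvectorBasis hn).sum_inner_mul_inner, map_sum]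
  refine Finset.sum_congr rfl fun j _ => ?_
  rw [hT, hT.apply_eigenvectorBasis, inner_smul_right, mul_assoc, RCLike.re_ofReal_mul,
    inner_mul_symm_re_eq_norm, norm_mul, norm_inner_symm, sq]

theorem re_inner_apply_self_le_eigenvalues_mul {i : Fin n} {x : E}
    (hx : ∀ j < i, inner 𝕜 (hT.eigenvectorBasis hn j) x = 0) :
    RCLike.re (inner 𝕜 (T x) x) ≤ hT.eigenvalues hn i * ‖x‖ ^ 2 := by
  rw [re_inner_apply_self_eq_sum_eigenvalues hn hT,
    ← (hT.eigenvectorBasis hn).sum_sq_norm_inner_right x, Finset.mul_sum]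
  refine Finset.sum_le_sum fun j _ => ?_
  rcases lt_or_ge j i with hj | hj
  · simp [hx j hj]
  · gcongr
    exact hT.eigenvalues_antitone hn hj

theorem eigenvalues_mul_le_re_inner_apply_self {i : Fin n} {x : E}
    (hx : ∀ j > i, inner 𝕜 (hT.eigenvectorBasis hn j) x = 0) :
    hT.eigenvalues hn i * ‖x‖ ^ 2 ≤ RCLike.re (inner 𝕜 (T x) x) := by
  rw [re_inner_apply_self_eq_sum_eigenvalues hn hT,
    ← (hT.eigenvectorBasis hn).sum_sq_norm_inner_right x, Finset.mul_sum]
  refine Finset.sum_le_sum fun j _ => ?_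
  rcases lt_or_ge i j with hj | hj
  · simp [hx j hj]
  · gcongr
    exact hT.eigenvalues_antitone hn hj

theorem le_eigenvalues_of_forall_mem {i : Fin n} {S : Submodule 𝕜 E}
    (hS : (i : ℕ) < Module.finrank 𝕜 S) {c : ℝ}
    (hc : ∀ x ∈ S, c * ‖x‖ ^ 2 ≤ RCLike.re (inner 𝕜 (T x) x)) : c ≤ hT.eigenvalues hn i := by
  obtain ⟨x, hxS, hx₀, hx⟩ := exists_mem_ne_zero_forall_inner_eq_zero
    (fun j : Finset.Iio i => hT.eigenvectorBasis hn j) (by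
      rwa [Fintype.card_coe, Fin.card_Iio])
  exact le_of_mul_le_mul_right ((hc x hxS).trans <|
    re_inner_apply_self_le_eigenvalues_mul hn hT fun j hj => hx ⟨j, Finset.mem_Iio.2 hj⟩)
    (by positivity)

theorem eigenvalues_le_of_forall_mem {i : Fin n} {S : Submodule 𝕜 E}
    (hS : n ≤ Module.finrank 𝕜 S + i) {c : ℝ}
    (hc : ∀ x ∈ S, RCLike.re (inner 𝕜 (T x) x) ≤ c * ‖x‖ ^ 2) : hT.eigenvalues hn i ≤ c := by
  obtain ⟨x, hxS, hx₀, hx⟩ := exists_mem_ne_zero_forall_inner_eq_zero (S := S)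
    (fun j : Finset.Ioi i => hT.eigenvectorBasis hn j) (by
      rw [Fintype.card_coe, Fin.card_Ioi]
      omega)
  exact le_of_mul_le_mul_right ((eigenvalues_mul_le_re_inner_apply_self hn hT
    fun j hj => hx ⟨j, Finset.mem_Ioi.2 hj⟩).trans (hc x hxS)) (by positivity)

theorem eigenvalues_mono (h : P ≤ Q) (i : Fin n) :
    hP.eigenvalues hn i ≤ hQ.eigenvalues hn i := by
  obtain ⟨x, -, hx₀, hx⟩ := exists_mem_ne_zero_forall_inner_eq_zero (𝕜 := 𝕜) (S := ⊤)
    (Sum.elim (fun j : Finset.Ioi i => hP.eigenvectorBasis hn j)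
      fun j : Finset.Iio i => hQ.eigenvectorBasis hn j) (by
      rw [Fintype.card_sum, Fintype.card_coe, Fintype.card_coe, Fin.card_Ioi, Fin.card_Iio,
        finrank_top, hn]
      omega)
  refine le_of_mul_le_mul_right ?_ (pow_pos (norm_pos_iff.2 hx₀) 2)
  calc hP.eigenvalues hn i * ‖x‖ ^ 2
      ≤ RCLike.re (inner 𝕜 (P x) x) :=
        eigenvalues_mul_le_re_inner_apply_self hn hP
          fun j hj => hx (.inl ⟨j, Finset.mem_Ioi.2 hj⟩)
    _ ≤ RCLike.re (inner 𝕜 (Q x) x) := by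
        simpa [inner_sub_left] using ((LinearMap.le_def P Q).1 h).2 x
    _ ≤ hQ.eigenvalues hn i * ‖x‖ ^ 2 :=
        re_inner_apply_self_le_eigenvalues_mul hn hQ
          fun j hj => hx (.inr ⟨j, Finset.mem_Iio.2 hj⟩)

theorem sum_max_eigenvalues_sub_le_re_trace (hD : D.IsPositive) (h : P - Q ≤ D) :
    ∑ i, max (hP.eigenvalues hn i - hQ.eigenvalues hn i) 0 ≤
      RCLike.re (LinearMap.trace 𝕜 E D) := by
  have hQD : (Q + D).IsSymmetric := hQ.add hD.isSymmetric
  have hQ_le := eigenvalues_mono hn hQ hQD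
    (le_add_of_nonneg_right (D.nonneg_iff_isPositive.2 hD))
  have hP_le := eigenvalues_mono hn hP hQD (sub_le_iff_le_add'.1 h)
  calc ∑ i, max (hP.eigenvalues hn i - hQ.eigenvalues hn i) 0
      ≤ ∑ i, (hQD.eigenvalues hn i - hQ.eigenvalues hn i) := Finset.sum_le_sum fun i _ =>
        max_le (sub_le_sub_right (hP_le i) _) (sub_nonneg.2 (hQ_le i))
    _ = RCLike.re (LinearMap.trace 𝕜 E D) := by
        rw [Finset.sum_sub_distrib, ← hQD.re_trace_eq_sum_eigenvalues hn,
          ← hQ.re_trace_eq_sum_eigenvalues hn, map_add, map_add, add_sub_cancel_left]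

/-- The positive part `∑ i, max λ_i 0 • ⟪u_i, ·⟫ u_i` of a symmetric operator with eigenvalues
`λ_i` and orthonormal eigenvectors `u_i`. It dominates the operator with the least possible
trace. -/
noncomputable def positivePart : E →ₗ[𝕜] E :=
  ∑ i, ((max (hT.eigenvalues hn i) 0 : ℝ) : 𝕜) •
    (InnerProductSpace.rankOne 𝕜 (hT.eigenvectorBasis hn i) (hT.eigenvectorBasis hn i) :
      E →ₗ[𝕜] E)

theorem isPositive_positivePart : (positivePart hn hT).IsPositive :=
  LinearMap.isPositive_sum _ fun _ _ =>
    (InnerProductSpace.isPositive_rankOne_self _).toLinearMap.smul_of_nonneg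
      (RCLike.ofReal_nonneg.2 (le_max_right _ _))

theorem re_inner_positivePart_apply_self (x : E) :
    RCLike.re (inner 𝕜 (positivePart hn hT x) x) =
      ∑ j, max (hT.eigenvalues hn j) 0 * ‖inner 𝕜 (hT.eigenvectorBasis hn j) x‖ ^ 2 := by
  simp only [positivePart, LinearMap.sum_apply, sum_inner, map_sum]
  refine Finset.sum_congr rfl fun j _ => ?_
  simp only [LinearMap.smul_apply, ContinuousLinearMap.coe_coe, InnerProductSpace.rankOne_apply,
    inner_smul_left, RCLike.conj_ofReal, RCLike.re_ofReal_mul, RCLike.conj_mul]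
  norm_cast

theorem le_positivePart : T ≤ positivePart hn hT := by
  refine ⟨(isPositive_positivePart hn hT).isSymmetric.sub hT, fun x => ?_⟩
  rw [LinearMap.sub_apply, inner_sub_left, map_sub, sub_nonneg,
    re_inner_apply_self_eq_sum_eigenvalues hn hT, re_inner_positivePart_apply_self]
  gcongr
  exact le_max_left _ _

theorem re_trace_positivePart :
    RCLike.re (LinearMap.trace 𝕜 E (positivePart hn hT)) = ∑ i, max (hT.eigenvalues hn i) 0 := by
  simp [positivePart, InnerProductSpace.trace_rankOne]

theorem sum_max_eigenvalues_sub_le :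
    ∑ i, max (hP.eigenvalues hn i - hQ.eigenvalues hn i) 0 ≤
      ∑ i, max ((hP.sub hQ).eigenvalues hn i) 0 := by
  rw [← re_trace_positivePart]
  exact sum_max_eigenvalues_sub_le_re_trace hn hP hQ (isPositive_positivePart hn (hP.sub hQ))
    (le_positivePart hn (hP.sub hQ))

theorem sum_max_eigenvalues_le_of_orthonormal {K : ℝ}
    (h : ∀ (s : Finset (Fin n)) (w : s → E), Orthonormal 𝕜 w →
      ∑ i, RCLike.re (inner 𝕜 (T (w i)) (w i)) ≤ K) :
    ∑ i, max (hT.eigenvalues hn i) 0 ≤ K := by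
  let s : Finset (Fin n) := {i | 0 < hT.eigenvalues hn i}
  calc ∑ i, max (hT.eigenvalues hn i) 0
      = ∑ i ∈ s, hT.eigenvalues hn i := by
        rw [Finset.sum_filter]
        refine Finset.sum_congr rfl fun i _ => ?_
        split_ifs with hi
        · exact max_eq_left hi.le
        · exact max_eq_right (not_lt.1 hi)
    _ = ∑ i : s, RCLike.re (inner 𝕜 (T (hT.eigenvectorBasis hn i)) (hT.eigenvectorBasis hn i)) := by
        rw [← Finset.sum_coe_sort]
        refine Finset.sum_congr rfl fun i _ => ?_
        rw [hT.apply_eigenvectorBasis, inner_smul_left, RCLike.conj_ofReal, RCLike.re_ofReal_mul,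
          (hT.eigenvectorBasis hn).inner_eq_one, RCLike.one_re, mul_one]
    _ ≤ K := h s _ ((hT.eigenvectorBasis hn).orthonormal.comp _ Subtype.val_injective)

end Eigenvalues

section HilbertSpaceOperators

variable {𝕜 H₁ H₂ : Type*} [RCLike 𝕜]
  [NormedAddCommGroup H₁] [InnerProductSpace 𝕜 H₁] [CompleteSpace H₁]
  [NormedAddCommGroup H₂] [InnerProductSpace 𝕜 H₂] [CompleteSpace H₂]

theorem sum_norm_sq_inner_apply_le_of_orthonormal {ι : Type*} [Fintype ι] {w : ι → H₁}
    (hw : Orthonormal 𝕜 w) {T : H₁ →ₗ[𝕜] H₂} {c : ℝ} (hc : 0 ≤ c) (hT : ∀ x, ‖T x‖ ≤ c * ‖x‖)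
    (z : H₂) : ∑ i, ‖inner 𝕜 z (T (w i))‖ ^ 2 ≤ c ^ 2 * ‖z‖ ^ 2 := by
  let R : H₁ →L[𝕜] H₂ := T.mkContinuous c hT
  have hR : ‖R.adjoint‖ ≤ c := by
    rw [LinearIsometryEquiv.norm_map]
    exact LinearMap.mkContinuous_norm_le _ hc _
  calc ∑ i, ‖inner 𝕜 z (T (w i))‖ ^ 2 = ∑ i, ‖inner 𝕜 (w i) (R.adjoint z)‖ ^ 2 := by
        refine Finset.sum_congr rfl fun i _ => ?_
        rw [ContinuousLinearMap.adjoint_inner_right, norm_inner_symm]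
        rfl
    _ ≤ ‖R.adjoint z‖ ^ 2 := hw.sum_inner_products_le _
    _ ≤ c ^ 2 * ‖z‖ ^ 2 := by
        rw [← mul_pow]
        gcongr
        exact R.adjoint.le_of_opNorm_le hR z

theorem sum_max_sq_sub_sq_le {E : Type*} [NormedAddCommGroup E] [InnerProductSpace 𝕜 E]
    [FiniteDimensional 𝕜 E] {n : ℕ} (hn : Module.finrank 𝕜 E = n)
    {F : E →ₗ[𝕜] H₁} {G : E →ₗ[𝕜] H₂} {b c : Fin n → ℝ} {K : ℝ} (hb : ∀ k, 0 ≤ b k)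
    (hF : ∀ k : Fin n, ∃ S : Submodule 𝕜 E,
      (k : ℕ) < Module.finrank 𝕜 S ∧ ∀ x ∈ S, b k * ‖x‖ ≤ ‖F x‖)
    (hG : ∀ k : Fin n, ∃ S : Submodule 𝕜 E,
      n ≤ Module.finrank 𝕜 S + k ∧ ∀ x ∈ S, ‖G x‖ ≤ c k * ‖x‖)
    (hFG : ∀ (s : Finset (Fin n)) (w : s → E), Orthonormal 𝕜 w →
      ∑ i, ‖F (w i)‖ ^ 2 ≤ K + ∑ i, ‖G (w i)‖ ^ 2) :
    ∑ k, max (b k ^ 2 - c k ^ 2) 0 ≤ K := by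
  have : CompleteSpace E := FiniteDimensional.complete 𝕜 E
  let F' := LinearMap.toContinuousLinearMap F
  let G' := LinearMap.toContinuousLinearMap G
  have hP := (ContinuousLinearMap.isPositive_adjoint_comp_self F').isSymmetric
  have hQ := (ContinuousLinearMap.isPositive_adjoint_comp_self G').isSymmetric
  have re_P (x : E) : RCLike.re (inner 𝕜 ((F'.adjoint ∘L F') x) x) = ‖F x‖ ^ 2 :=
    (F'.apply_norm_sq_eq_inner_adjoint_left x).symm
  have re_Q (x : E) : RCLike.re (inner 𝕜 ((G'.adjoint ∘L G') x) x) = ‖G x‖ ^ 2 :=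
    (G'.apply_norm_sq_eq_inner_adjoint_left x).symm
  have b_le (k : Fin n) : b k ^ 2 ≤ hP.eigenvalues hn k := by
    obtain ⟨S, hS, h⟩ := hF k
    refine le_eigenvalues_of_forall_mem hn hP hS fun x hx => ?_
    rw [← mul_pow]
    exact (pow_le_pow_left₀ (mul_nonneg (hb k) (norm_nonneg x)) (h x hx) 2).trans_eq (re_P x).symm
  have le_c (k : Fin n) : hQ.eigenvalues hn k ≤ c k ^ 2 := by
    obtain ⟨S, hS, h⟩ := hG k
    refine eigenvalues_le_of_forall_mem hn hQ hS fun x hx => ?_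
    rw [← mul_pow]
    exact (re_Q x).trans_le (pow_le_pow_left₀ (norm_nonneg _) (h x hx) 2)
  calc ∑ k, max (b k ^ 2 - c k ^ 2) 0
      ≤ ∑ k, max (hP.eigenvalues hn k - hQ.eigenvalues hn k) 0 :=
        Finset.sum_le_sum fun k _ => max_le_max_right 0 (sub_le_sub (b_le k) (le_c k))
    _ ≤ ∑ k, max ((hP.sub hQ).eigenvalues hn k) 0 := sum_max_eigenvalues_sub_le hn hP hQ
    _ ≤ K := sum_max_eigenvalues_le_of_orthonormal hn (hP.sub hQ) fun s w hw => by
        have re_sub (x : E) : RCLike.re (inner 𝕜 (((F'.adjoint ∘L F' : E →L[𝕜] E) -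
            (G'.adjoint ∘L G' : E →L[𝕜] E) : E →ₗ[𝕜] E) x) x) = ‖F x‖ ^ 2 - ‖G x‖ ^ 2 := by
          rw [← re_P, ← re_Q, ← map_sub, ← inner_sub_left]
          rfl
        simp only [re_sub, Finset.sum_sub_distrib]
        exact sub_le_iff_le_add.2 (hFG s w hw)

end HilbertSpaceOperators

section CompletelyBounded

variable {H K : Type*} [NormedAddCommGroup H] [InnerProductSpace ℂ H]
  [NormedAddCommGroup K] [InnerProductSpace ℂ K]
variable {X : Submodule ℂ (H →L[ℂ] H)} {Y : Submodule ℂ (K →L[ℂ] K)} {n : ℕ}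

theorem matOp_smul (c : ℂ) (a : Matrix (Fin n) (Fin n) (H →L[ℂ] H)) :
    matOp (c • a) = c • matOp a := by
  ext v i
  simp [matOp_apply, Finset.smul_sum]

theorem matNorm_smul_le (c : ℂ) (x : Matrix (Fin n) (Fin n) X) :
    matNorm X (c • x) ≤ ‖c‖ * matNorm X x := by
  change ‖matOp (c • x.map (Subtype.val : X → H →L[ℂ] H))‖ ≤ _
  rw [matOp_smul]
  exact ContinuousLinearMap.opNorm_smul_le c _

theorem matNorm_nonneg (x : Matrix (Fin n) (Fin n) X) : 0 ≤ matNorm X x :=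
  ContinuousLinearMap.opNorm_nonneg _

theorem ofReal_matNorm_map_le_cbNorm (u : X →ₗ[ℂ] Y) {x : Matrix (Fin n) (Fin n) X}
    (hx : matNorm X x ≤ 1) : ENNReal.ofReal (matNorm Y (x.map u)) ≤ cbNorm u := by
  unfold cbNorm
  exact le_iSup_of_le n (le_iSup_of_le x (le_iSup_of_le hx le_rfl))

theorem matNorm_map_le {u : X →ₗ[ℂ] Y} {C : ℝ≥0} (hu : cbNorm u ≤ C)
    (x : Matrix (Fin n) (Fin n) X) : matNorm Y (x.map u) ≤ C * matNorm X x := by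
  suffices h : ∀ t > matNorm X x, matNorm Y (x.map u) ≤ C * t from
    ge_of_tendsto ((continuous_const_mul (C : ℝ)).continuousWithinAt (s := Set.Ioi (matNorm X x)))
      (eventually_nhdsWithin_of_forall h)
  intro t ht
  have ht₀ : 0 < t := (matNorm_nonneg x).trans_lt ht
  have norm_ofReal {r : ℝ} (hr : 0 < r) : ‖(r : ℂ)‖ = r := by
    rw [Complex.norm_real, Real.norm_of_nonneg hr.le]
  set y := ((t⁻¹ : ℝ) : ℂ) • x with hy
  have y_le : matNorm X y ≤ 1 := by
    refine (matNorm_smul_le _ _).trans ?_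
    rw [norm_ofReal (inv_pos.2 ht₀), inv_mul_le_one₀ ht₀]
    exact ht.le
  have image_le : ENNReal.ofReal (matNorm Y (y.map u)) ≤ C :=
    (ofReal_matNorm_map_le_cbNorm u y_le).trans hu
  rw [← ENNReal.ofReal_coe_nnreal, ENNReal.ofReal_le_ofReal_iff C.coe_nonneg] at image_le
  have hx : x.map u = (t : ℂ) • y.map u := by
    ext i j : 2
    simp [hy, smul_smul, ht₀.ne']
  calc matNorm Y (x.map u) ≤ t * matNorm Y (y.map u) := by
        rw [hx]
        exact (matNorm_smul_le _ _).trans_eq (by rw [norm_ofReal ht₀])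
    _ ≤ C * t := by
        rw [mul_comm]
        gcongr

theorem cbNorm_le_of_matNorm_map_le {u : X →ₗ[ℂ] Y} {C : ℝ≥0}
    (h : ∀ (n : ℕ) (x : Matrix (Fin n) (Fin n) X), matNorm X x ≤ 1 → matNorm Y (x.map u) ≤ C) :
    cbNorm u ≤ C :=
  iSup_le fun n => iSup₂_le fun x hx => ENNReal.ofReal_le_of_le_toReal (h n x hx)

end CompletelyBounded

section RowColumn

theorem inner_xi_left (i : ℕ) (z : L2) : inner ℂ (xi i) z = z i := by
  simp [xi, lp.inner_single_left]

theorem xi_apply (i j : ℕ) : xi i j = if j = i then 1 else 0 := by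
  simp [xi, lp.single_apply, Pi.single_apply]

theorem star_xi (i : ℕ) : star (xi i) = xi i := by
  ext j
  simp [xi_apply]

theorem orthonormal_xi : Orthonormal ℂ xi := by
  rw [orthonormal_iff_ite]
  intro i j
  rw [inner_xi_left, xi_apply]

theorem inner_star_comm (a b : L2) : inner ℂ (star a) b = inner ℂ (star b) a := by
  rw [lp.inner_eq_tsum, lp.inner_eq_tsum]
  refine tsum_congr fun i => ?_
  simp [mul_comm]

variable {m n : Type*}

/-- The matrix with entries in `X(A)` whose entry `(i, j)` is `(V i j, A (V i j))`. -/
noncomputable def matX (A : L2 →L[ℂ] L2) (V : Matrix m n L2) : Matrix m n (XA A) :=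
  V.map (toX A)

theorem matX_map_symm (A : L2 →L[ℂ] L2) (x : Matrix m n (XA A)) :
    matX A (x.map (toX A).symm) = x := by
  ext i j : 2
  simp [matX]

variable [Fintype m] [Fintype n]

/-- The norm of a matrix over the row space `R` is at most `M ≥ 0`. The entries of the matrix are
written as vectors of `ℓ₂`, `x` standing for `∑ j, x_j E_{0j}`. -/
def IsRowBound (V : Matrix m n L2) (M : ℝ) : Prop :=
  ∀ p : n → L2, ∑ i, ‖∑ j, inner ℂ (star (V i j)) (p j)‖ ^ 2 ≤ M ^ 2 * ∑ j, ‖p j‖ ^ 2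

/-- The norm of a matrix over the column space `C` is at most `M ≥ 0`. The entries of the matrix
are written as vectors of `ℓ₂`, `y` standing for `∑ i, y_i E_{i0}`. -/
def IsColBound (V : Matrix m n L2) (M : ℝ) : Prop :=
  ∀ q : n → ℂ, ∑ i, ‖∑ j, q j • V i j‖ ^ 2 ≤ M ^ 2 * ∑ j, ‖q j‖ ^ 2

theorem IsRowBound.sum_norm_sq_apply_le {V : Matrix m n L2} {M : ℝ} (h : IsRowBound V M)
    (q : n → ℂ) (k : ℕ) : ∑ i, ‖(∑ j, q j • V i j : L2) k‖ ^ 2 ≤ M ^ 2 * ∑ j, ‖q j‖ ^ 2 := by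
  have apply_eq (i : m) :
      (∑ j, q j • V i j : L2) k = ∑ j, inner ℂ (star (V i j)) (q j • xi k) := by
    rw [← inner_xi_left, inner_sum]
    refine Finset.sum_congr rfl fun j _ => ?_
    rw [inner_smul_right, inner_smul_right, inner_star_comm, star_xi]
  simp only [apply_eq]
  simpa only [norm_smul, norm_xi, mul_one] using h fun j => q j • xi k

theorem norm_sq_piLp_prod {ι : Type*} [Fintype ι] {E F : Type*} [NormedAddCommGroup E]
    [NormedAddCommGroup F] (v : PiLp 2 (fun _ : ι => WithLp 2 (E × F))) :
    ‖v‖ ^ 2 = ∑ j, ‖(v j).fst‖ ^ 2 + ∑ j, ‖(v j).snd‖ ^ 2 := by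
  rw [PiLp.norm_sq_eq_of_L2, ← Finset.sum_add_distrib]
  exact Finset.sum_congr rfl fun j _ => WithLp.prod_norm_sq_eq_of_L2 _

theorem toX_apply (A : L2 →L[ℂ] L2) (x : L2) (v : WithLp 2 (L2 × L2)) :
    (toX A x : WithLp 2 (L2 × L2) →L[ℂ] WithLp 2 (L2 × L2)) v =
      WithLp.toLp 2 (inner ℂ (star x) v.fst • xi 0, v.snd 0 • A x) := by
  change dirSum (rowOp x) (colOp (A x)) v = _
  rw [dirSum_apply, rowOp, colOp, InnerProductSpace.rankOne_apply,
    InnerProductSpace.rankOne_apply, inner_xi_left]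

theorem norm_sq_matOp_matX {r : ℕ} (A : L2 →L[ℂ] L2) (V : Matrix (Fin r) (Fin r) L2)
    (v : PiLp 2 (fun _ : Fin r => WithLp 2 (L2 × L2))) :
    ‖matOp ((matX A V).map Subtype.val) v‖ ^ 2 =
      ∑ i, ‖∑ j, inner ℂ (star (V i j)) (v j).fst‖ ^ 2 +
        ∑ i, ‖∑ j, (v j).snd 0 • V.map A i j‖ ^ 2 := by
  have apply_eq (i : Fin r) : matOp ((matX A V).map Subtype.val) v i =
      WithLp.toLp 2 (∑ j, inner ℂ (star (V i j)) (v j).fst • xi 0,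
        ∑ j, (v j).snd 0 • V.map A i j) := by
    simp only [matOp_apply, matX, Matrix.map_apply, toX_apply]
    rw [← WithLp.toLp_sum, ← prod_mk_sum]
  simp only [norm_sq_piLp_prod, apply_eq, WithLp.toLp_fst, WithLp.toLp_snd, ← Finset.sum_smul,
    norm_smul, norm_xi, mul_one]

theorem matNorm_matX_le_iff {r : ℕ} {A : L2 →L[ℂ] L2} {V : Matrix (Fin r) (Fin r) L2} {M : ℝ}
    (hM : 0 ≤ M) :
    matNorm (XA A) (matX A V) ≤ M ↔ IsRowBound V M ∧ IsColBound (V.map A) M := by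
  constructor
  · intro h
    have bound (v : PiLp 2 (fun _ : Fin r => WithLp 2 (L2 × L2))) :
        ∑ i, ‖∑ j, inner ℂ (star (V i j)) (v j).fst‖ ^ 2 +
            ∑ i, ‖∑ j, (v j).snd 0 • V.map A i j‖ ^ 2 ≤
          M ^ 2 * (∑ j, ‖(v j).fst‖ ^ 2 + ∑ j, ‖(v j).snd‖ ^ 2) := by
      rw [← norm_sq_matOp_matX, ← norm_sq_piLp_prod, ← mul_pow]
      exact pow_le_pow_left₀ (norm_nonneg _) (ContinuousLinearMap.le_of_opNorm_le _ h v) 2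
    constructor
    · intro p
      simpa using bound (WithLp.toLp 2 fun j => WithLp.toLp 2 (p j, 0))
    · intro q
      simpa [norm_smul, norm_xi, xi_apply] using
        bound (WithLp.toLp 2 fun j => WithLp.toLp 2 (0, q j • xi 0))
  · rintro ⟨hrow, hcol⟩
    refine ContinuousLinearMap.opNorm_le_bound _ hM fun v => ?_
    refine le_of_sq_le_sq ?_ (mul_nonneg hM (norm_nonneg v))
    rw [norm_sq_matOp_matX, mul_pow, norm_sq_piLp_prod, mul_add]
    refine add_le_add (hrow _) ((hcol _).trans ?_)
    gcongr with j
    exact lp.norm_apply_le_norm two_ne_zero _ 0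

end RowColumn

section RowColumnMaps

theorem isRowBound_updateCol_zero_iff {m n : Type*} [Fintype m] [Fintype n] [DecidableEq n]
    {j₀ : n} {v : m → L2} {M : ℝ} :
    IsRowBound (Matrix.updateCol 0 j₀ v) M ↔
      ∀ z, ∑ i, ‖inner ℂ z (v i)‖ ^ 2 ≤ M ^ 2 * ‖z‖ ^ 2 := by
  have sum_eq (p : n → L2) (i : m) :
      ∑ j, inner ℂ (star (Matrix.updateCol 0 j₀ v i j)) (p j) = inner ℂ (star (p j₀)) (v i) := by
    rw [Finset.sum_eq_single j₀ (fun j _ hj => by simp [hj]) (by simp), Matrix.updateCol_self,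
      inner_star_comm]
  simp only [IsRowBound, sum_eq]
  constructor
  · intro h z
    simpa [Pi.single_apply, apply_ite] using h (Pi.single j₀ (star z))
  · intro h p
    refine (h _).trans ?_
    rw [norm_star]
    gcongr
    exact Finset.single_le_sum (f := fun j => ‖p j‖ ^ 2) (fun _ _ => sq_nonneg _)
      (Finset.mem_univ j₀)

theorem isColBound_updateCol_zero_iff {m n : Type*} [Fintype m] [Fintype n] [DecidableEq n]
    {j₀ : n} {v : m → L2} {M : ℝ} :
    IsColBound (Matrix.updateCol 0 j₀ v) M ↔ ∑ i, ‖v i‖ ^ 2 ≤ M ^ 2 := by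
  have sum_eq (q : n → ℂ) (i : m) : ∑ j, q j • Matrix.updateCol 0 j₀ v i j = q j₀ • v i := by
    rw [Finset.sum_eq_single j₀ (fun j _ hj => by simp [hj]) (by simp), Matrix.updateCol_self]
  simp only [IsColBound, sum_eq, norm_smul, mul_pow, ← Finset.mul_sum]
  constructor
  · intro h
    simpa [Pi.single_apply, apply_ite] using h (Pi.single j₀ 1)
  · intro h q
    rw [mul_comm]
    gcongr
    exact Finset.single_le_sum (f := fun j => ‖q j‖ ^ 2) (fun _ _ => sq_nonneg _)
      (Finset.mem_univ j₀)

variable {A B : L2 →L[ℂ] L2}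

/-- The linear map on `ℓ₂` which represents a linear map `X(A) → X(B)` in the coordinates
`x ↦ (x, A x)` and `x ↦ (x, B x)`. -/
noncomputable def coordMap (u : XA A →ₗ[ℂ] XA B) : L2 →ₗ[ℂ] L2 :=
  (toX B).symm.toLinearMap ∘ₗ u ∘ₗ (toX A).toLinearMap

theorem matX_map {m n : Type*} (u : XA A →ₗ[ℂ] XA B) (V : Matrix m n L2) :
    (matX A V).map u = matX B (V.map (coordMap u)) := by
  ext i j : 2
  simp [matX, coordMap]

variable {u : XA A →ₗ[ℂ] XA B} {v : XA B →ₗ[ℂ] XA A} {C D : ℝ≥0} {ι : Type*} [Fintype ι]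

theorem coordMap_coordMap (huv : u ∘ₗ v = LinearMap.id) (x : L2) :
    coordMap u (coordMap v x) = x := by
  simp [coordMap, ← LinearMap.comp_apply u v, huv]

theorem column_bounds_coordMap (hu : cbNorm u ≤ C) {w : ι → L2} {M : ℝ} (hM : 0 ≤ M)
    (hrow : ∀ z, ∑ i, ‖inner ℂ z (w i)‖ ^ 2 ≤ M ^ 2 * ‖z‖ ^ 2)
    (hcol : ∑ i, ‖A (w i)‖ ^ 2 ≤ M ^ 2) :
    (∀ z, ∑ i, ‖inner ℂ z (coordMap u (w i))‖ ^ 2 ≤ (C * M) ^ 2 * ‖z‖ ^ 2) ∧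
      ∑ i, ‖B (coordMap u (w i))‖ ^ 2 ≤ (C * M) ^ 2 := by
  rcases isEmpty_or_nonempty ι with _ | ⟨⟨i₀⟩⟩
  · simp only [Finset.univ_eq_empty, Finset.sum_empty]
    exact ⟨fun _ => by positivity, by positivity⟩
  let e := Fintype.equivFin ι
  have key := (matNorm_map_le hu _).trans <| mul_le_mul_of_nonneg_left
    ((matNorm_matX_le_iff (A := A) (V := Matrix.updateCol 0 (e i₀) (w ∘ e.symm)) hM).2 ?_)
    C.coe_nonneg
  · rw [matX_map, matNorm_matX_le_iff (by positivity)] at key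
    simp only [Matrix.map_updateCol, Matrix.map_zero, map_zero, isRowBound_updateCol_zero_iff,
      isColBound_updateCol_zero_iff, Function.comp_apply] at key
    exact ⟨fun z => (e.symm.sum_comp fun i => ‖inner ℂ z (coordMap u (w i))‖ ^ 2).symm.trans_le
      (key.1 z), (e.symm.sum_comp fun i => ‖B (coordMap u (w i))‖ ^ 2).symm.trans_le key.2⟩
  · simp only [Matrix.map_updateCol, Matrix.map_zero, map_zero, isRowBound_updateCol_zero_iff,
      isColBound_updateCol_zero_iff, Function.comp_apply]
    exact ⟨fun z => (e.symm.sum_comp fun i => ‖inner ℂ z (w i)‖ ^ 2).trans_le (hrow z),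
      (e.symm.sum_comp fun i => ‖A (w i)‖ ^ 2).trans_le hcol⟩

theorem norm_coordMap_le (hA : ‖A‖ ≤ 1) (hu : cbNorm u ≤ C) (x : L2) :
    ‖coordMap u x‖ ≤ C * ‖x‖ := by
  have hrow := (column_bounds_coordMap hu (w := fun _ : Unit => x) (norm_nonneg x)
    (fun z => by
      rw [Finset.univ_unique, Finset.sum_singleton, ← mul_pow, mul_comm]
      gcongr
      exact norm_inner_le_norm z x)
    (by
      rw [Finset.univ_unique, Finset.sum_singleton]
      gcongr
      simpa using A.le_of_opNorm_le hA x)).1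
  simp only [Finset.univ_unique, Finset.sum_singleton, ← mul_pow] at hrow
  rw [← innerSL_apply_norm ℂ]
  refine ContinuousLinearMap.opNorm_le_bound _ (by positivity) fun z => ?_
  rw [innerSL_apply_apply, norm_inner_symm]
  exact le_of_sq_le_sq (hrow z) (by positivity)

theorem one_le_mul_of_cbNorm_le (hA : ‖A‖ ≤ 1) (hB : ‖B‖ ≤ 1) (huv : u ∘ₗ v = LinearMap.id)
    (hu : cbNorm u ≤ C) (hv : cbNorm v ≤ D) : 1 ≤ C * D := by
  have h : ‖xi 0‖ ≤ C * (D * ‖xi 0‖) := by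
    calc ‖xi 0‖ = ‖coordMap u (coordMap v (xi 0))‖ := by rw [coordMap_coordMap huv]
      _ ≤ C * ‖coordMap v (xi 0)‖ := norm_coordMap_le hA hu _
      _ ≤ C * (D * ‖xi 0‖) := by
          gcongr
          exact norm_coordMap_le hB hv _
  rw [norm_xi, mul_one] at h
  exact_mod_cast h

theorem sum_norm_sq_le_of_orthonormal (hB : ‖B‖ ≤ 1) (huv : u ∘ₗ v = LinearMap.id)
    (hu : cbNorm u ≤ C) (hv : cbNorm v ≤ D) {w : ι → L2} (hw : Orthonormal ℂ w) :
    ∑ i, ‖B (w i)‖ ^ 2 ≤ C ^ 2 * (D ^ 2 + ∑ i, ‖A (coordMap v (w i))‖ ^ 2) := by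
  set s := ∑ i, ‖A (coordMap v (w i))‖ ^ 2 with hs
  have hs₀ : 0 ≤ s := Finset.sum_nonneg fun _ _ => sq_nonneg _
  have hM : √(D ^ 2 + s) ^ 2 = D ^ 2 + s := Real.sq_sqrt (by positivity)
  have hcol := (column_bounds_coordMap hu (w := fun i => coordMap v (w i))
    (Real.sqrt_nonneg (D ^ 2 + s))
    (fun z => by
      refine (sum_norm_sq_inner_apply_le_of_orthonormal hw D.coe_nonneg
        (norm_coordMap_le hB hv) z).trans ?_
      rw [hM]
      gcongr
      exact le_add_of_nonneg_right hs₀)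
    (by
      rw [hM, ← hs]
      exact le_add_of_nonneg_left (sq_nonneg _))).2
  simpa only [mul_pow, hM, coordMap_coordMap huv] using hcol

end RowColumnMaps

section Diagonal

theorem norm_diag_le (α : ℕ → unitInterval) : ‖diag α‖ ≤ 1 :=
  LinearMap.mkContinuous_norm_le _ zero_le_one _

theorem norm_diag_apply (α : ℕ → unitInterval) (x : L2) (i : ℕ) :
    ‖diag α x i‖ = α i * ‖x i‖ := by
  rw [diag_apply, norm_mul, Complex.norm_real, Real.norm_of_nonneg (α i).2.1]

theorem norm_ofReal_smul {r : ℝ} (hr : 0 ≤ r) (x : L2) : ‖(r : ℂ) • x‖ = r * ‖x‖ := by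
  rw [norm_smul, Complex.norm_real, Real.norm_of_nonneg hr]

theorem norm_diag_le_of_forall_lt {α : ℕ → unitInterval} (hα : Antitone α) {k : ℕ} {x : L2}
    (hx : ∀ i < k, x i = 0) : ‖diag α x‖ ≤ α k * ‖x‖ := by
  rw [← norm_ofReal_smul (α k).2.1]
  refine lp.norm_mono two_ne_zero fun i => ?_
  rw [norm_diag_apply, lp.coeFn_smul, Pi.smul_apply, norm_smul, Complex.norm_real,
    Real.norm_of_nonneg (α k).2.1]
  rcases lt_or_ge i k with hi | hi
  · simp [hx i hi]
  · gcongr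
    exact hα hi

theorem le_norm_diag_of_forall_gt {α : ℕ → unitInterval} (hα : Antitone α) {k : ℕ} {x : L2}
    (hx : ∀ i > k, x i = 0) : α k * ‖x‖ ≤ ‖diag α x‖ := by
  rw [← norm_ofReal_smul (α k).2.1]
  refine lp.norm_mono two_ne_zero fun i => ?_
  rw [norm_diag_apply, lp.coeFn_smul, Pi.smul_apply, norm_smul, Complex.norm_real,
    Real.norm_of_nonneg (α k).2.1]
  rcases lt_or_ge k i with hi | hi
  · simp [hx i hi]
  · gcongr
    exact hα hi

theorem hasSum_norm_sq_diag (α : ℕ → unitInterval) (x : L2) :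
    HasSum (fun k => (α k : ℝ) ^ 2 * ‖x k‖ ^ 2) (‖diag α x‖ ^ 2) := by
  simpa only [ENNReal.toReal_ofNat, Real.rpow_ofNat, norm_diag_apply, mul_pow] using
    lp.hasSum_norm (p := 2) (by norm_num) (diag α x)

/-- The span `ℓ₂ⁿ ⊆ ℓ₂` of the first `n` vectors of the canonical basis. -/
noncomputable def coordSpan (n : ℕ) : Submodule ℂ L2 :=
  Submodule.span ℂ (Set.range fun i : Fin n => xi i)

instance finiteDimensional_coordSpan (n : ℕ) : FiniteDimensional ℂ (coordSpan n) :=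
  FiniteDimensional.span_of_finite ℂ (Set.finite_range _)

theorem finrank_coordSpan (n : ℕ) : Module.finrank ℂ (coordSpan n) = n :=
  (finrank_span_eq_card (orthonormal_xi.linearIndependent.comp _ Fin.val_injective)).trans
    (Fintype.card_fin n)

theorem coordSpan_mono : Monotone coordSpan := fun _ _ h =>
  Submodule.span_mono <| Set.range_subset_iff.2 fun i => ⟨i.castLE h, rfl⟩

theorem apply_eq_zero_of_mem_coordSpan {n : ℕ} {x : L2} (hx : x ∈ coordSpan n) {i : ℕ}
    (hi : n ≤ i) : x i = 0 := by
  have h : coordSpan n ≤ (innerₛₗ ℂ (xi i)).ker := Submodule.span_le.2 <|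
    Set.range_subset_iff.2 fun j => by
      simp [inner_xi_left, xi_apply, (j.2.trans_le hi).ne']
  rw [← inner_xi_left]
  exact h hx

variable {α β : ℕ → unitInterval} {C D : ℝ≥0} {u : Xd α →ₗ[ℂ] Xd β} {v : Xd β →ₗ[ℂ] Xd α}

theorem exists_finrank_gt_forall_le_norm_diag (hβ : Antitone β) {n : ℕ} (k : Fin n) :
    ∃ S : Submodule ℂ (coordSpan n),
      (k : ℕ) < Module.finrank ℂ S ∧ ∀ x ∈ S, β k * ‖x‖ ≤ ‖diag β x‖ := by
  refine ⟨(coordSpan (k + 1)).comap (coordSpan n).subtype, ?_, fun x hx =>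
    le_norm_diag_of_forall_gt hβ fun i hi => apply_eq_zero_of_mem_coordSpan hx hi⟩
  rw [(Submodule.comapSubtypeEquivOfLe (coordSpan_mono k.2)).finrank_eq, finrank_coordSpan]
  exact Nat.lt_succ_self k

theorem exists_le_finrank_add_forall_norm_diag_le (hα : Antitone α) {E : Type*}
    [NormedAddCommGroup E] [InnerProductSpace ℂ E] [FiniteDimensional ℂ E] {T : E →ₗ[ℂ] L2}
    {c : ℝ} (hT : ∀ x, ‖T x‖ ≤ c * ‖x‖) (k : ℕ) :
    ∃ S : Submodule ℂ E,
      Module.finrank ℂ E ≤ Module.finrank ℂ S + k ∧ ∀ x ∈ S, ‖diag α (T x)‖ ≤ c * α k * ‖x‖ := by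
  let φ : E →ₗ[ℂ] Fin k → ℂ := LinearMap.pi fun i => innerₛₗ ℂ (xi i) ∘ₗ T
  refine ⟨φ.ker, ?_, fun x hx => ?_⟩
  · rw [← φ.finrank_range_add_finrank_ker, add_comm]
    gcongr
    simpa using φ.range.finrank_le
  · have hTx : ∀ i < k, T x i = 0 := fun i hi => by
      rw [← inner_xi_left]
      exact congr_fun (LinearMap.mem_ker.1 hx) ⟨i, hi⟩
    calc ‖diag α (T x)‖ ≤ α k * ‖T x‖ := norm_diag_le_of_forall_lt hα hTx
      _ ≤ α k * (c * ‖x‖) := mul_le_mul_of_nonneg_left (hT x) (α k).2.1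
      _ = c * α k * ‖x‖ := by ring

theorem sum_max_sq_sub_le (hα : Antitone α) (hβ : Antitone β) (huv : u ∘ₗ v = LinearMap.id)
    (hu : cbNorm u ≤ C) (hv : cbNorm v ≤ D) (n : ℕ) :
    ∑ k ∈ Finset.range n, max ((β k : ℝ) ^ 2 - (C * D) ^ 2 * α k ^ 2) 0 ≤ (C * D : ℝ) ^ 2 := by
  let ι := (coordSpan n).subtypeₗᵢ
  have norm_G (x : coordSpan n) :
      ‖((C : ℝ) : ℂ) • diag α (coordMap v x)‖ = C * ‖diag α (coordMap v x)‖ :=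
    norm_ofReal_smul C.coe_nonneg _
  have norm_v (x : coordSpan n) : ‖coordMap v x‖ ≤ D * ‖x‖ :=
    norm_coordMap_le (norm_diag_le β) hv x
  simp only [← mul_pow]
  rw [Finset.sum_range]
  refine sum_max_sq_sub_sq_le (finrank_coordSpan n)
    (F := (diag β).toLinearMap ∘ₗ ι.toLinearMap)
    (G := ((C : ℝ) : ℂ) • (diag α).toLinearMap ∘ₗ coordMap v ∘ₗ ι.toLinearMap)
    (fun k => (β k).2.1) (exists_finrank_gt_forall_le_norm_diag hβ) (fun k => ?_)
    (fun s w hw => ?_)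
  · obtain ⟨S, hS, hGS⟩ := exists_le_finrank_add_forall_norm_diag_le hα
      (T := coordMap v ∘ₗ ι.toLinearMap) norm_v k
    rw [finrank_coordSpan] at hS
    refine ⟨S, hS, fun x hx => (norm_G x).trans_le ?_⟩
    rw [mul_assoc, mul_assoc, ← mul_assoc (D : ℝ)]
    exact mul_le_mul_of_nonneg_left (hGS x hx) C.coe_nonneg
  · calc ∑ i, ‖diag β (ι (w i))‖ ^ 2
        ≤ C ^ 2 * (D ^ 2 + ∑ i, ‖diag α (coordMap v (ι (w i)))‖ ^ 2) :=
          sum_norm_sq_le_of_orthonormal (norm_diag_le β) huv hu hv (hw.comp_linearIsometry ι)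
      _ = (C * D) ^ 2 + ∑ i, ‖((C : ℝ) : ℂ) • diag α (coordMap v (w i))‖ ^ 2 := by
          simp only [norm_G, mul_pow, ← Finset.mul_sum]
          exact mul_add _ _ _

theorem sum_norm_sq_diag_le {ι : Type*} [Fintype ι] {a b s : ℝ} (ha : 0 ≤ a) (hs : 0 ≤ s)
    (hab : ∀ n, ∑ k ∈ Finset.range n, max ((β k : ℝ) ^ 2 - a * α k ^ 2) 0 ≤ b) {y : ι → L2}
    (hα : ∑ i, ‖diag α (y i)‖ ^ 2 ≤ s) (hy : ∀ k, ∑ i, ‖y i k‖ ^ 2 ≤ s) :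
    ∑ i, ‖diag β (y i)‖ ^ 2 ≤ (a + b) * s := by
  have hasSum_col (γ : ℕ → unitInterval) :
      HasSum (fun k => (γ k : ℝ) ^ 2 * ∑ i, ‖y i k‖ ^ 2) (∑ i, ‖diag γ (y i)‖ ^ 2) := by
    simp only [Finset.mul_sum]
    exact hasSum_sum fun i _ => hasSum_norm_sq_diag γ (y i)
  have hy₀ (k : ℕ) : 0 ≤ ∑ i, ‖y i k‖ ^ 2 := Finset.sum_nonneg fun _ _ => sq_nonneg _
  rw [← (hasSum_col β).tsum_eq]
  refine Real.tsum_le_of_sum_range_le (fun k => mul_nonneg (sq_nonneg _) (hy₀ k)) fun n => ?_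
  calc ∑ k ∈ Finset.range n, (β k : ℝ) ^ 2 * ∑ i, ‖y i k‖ ^ 2
      ≤ ∑ k ∈ Finset.range n, (a * ((α k : ℝ) ^ 2 * ∑ i, ‖y i k‖ ^ 2) +
          max ((β k : ℝ) ^ 2 - a * α k ^ 2) 0 * s) := by
        refine Finset.sum_le_sum fun k _ => ?_
        have h₁ := mul_le_mul_of_nonneg_right
          (le_max_left ((β k : ℝ) ^ 2 - a * α k ^ 2) 0) (hy₀ k)
        have h₂ := mul_le_mul_of_nonneg_left (hy k)
          (le_max_right ((β k : ℝ) ^ 2 - a * α k ^ 2) 0)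
        linarith
    _ ≤ a * s + b * s := by
        rw [Finset.sum_add_distrib, ← Finset.mul_sum, ← Finset.sum_mul]
        gcongr
        · exact (sum_le_hasSum _ (fun k _ => mul_nonneg (sq_nonneg _) (hy₀ k))
            (hasSum_col α)).trans hα
        · exact hab n
    _ = (a + b) * s := (add_mul a b s).symm

theorem coordMap_formalId (α β : ℕ → unitInterval) :
    coordMap (formalId α β : Xd α →ₗ[ℂ] Xd β) = LinearMap.id := by
  ext1 x
  simp [coordMap, formalId]

theorem cbNorm_formalId_le {a b : ℝ} {M : ℝ≥0} (ha : 0 ≤ a) (hM : 1 ≤ M) (haM : a + b ≤ M ^ 2)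
    (hab : ∀ n, ∑ k ∈ Finset.range n, max ((β k : ℝ) ^ 2 - a * α k ^ 2) 0 ≤ b) :
    cbNorm (formalId α β : Xd α →ₗ[ℂ] Xd β) ≤ M := by
  refine cbNorm_le_of_matNorm_map_le fun r x hx => ?_
  obtain ⟨V, rfl⟩ : ∃ V, matX (diag α) V = x := ⟨_, matX_map_symm _ x⟩
  obtain ⟨hrow, hcol⟩ := (matNorm_matX_le_iff zero_le_one).1 hx
  rw [matX_map, coordMap_formalId, matNorm_matX_le_iff M.coe_nonneg]
  refine ⟨fun p => (hrow p).trans ?_, fun q => ?_⟩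
  · gcongr
    exact_mod_cast hM
  · have hs : 0 ≤ ∑ j, ‖q j‖ ^ 2 := Finset.sum_nonneg fun _ _ => sq_nonneg _
    have diag_sum (γ : ℕ → unitInterval) (i : Fin r) :
        ∑ j, q j • V.map (diag γ) i j = diag γ (∑ j, q j • V i j) := by
      simp only [map_sum, map_smul, Matrix.map_apply]
    have hα : ∑ i, ‖diag α (∑ j, q j • V i j)‖ ^ 2 ≤ ∑ j, ‖q j‖ ^ 2 := by
      simpa only [diag_sum, one_pow, one_mul] using hcol q
    have hV (k : ℕ) : ∑ i, ‖(∑ j, q j • V i j : L2) k‖ ^ 2 ≤ ∑ j, ‖q j‖ ^ 2 := by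
      simpa only [one_pow, one_mul] using hrow.sum_norm_sq_apply_le q k
    calc ∑ i, ‖∑ j, q j • V.map (diag β) i j‖ ^ 2
        = ∑ i, ‖diag β (∑ j, q j • V i j)‖ ^ 2 := by simp only [diag_sum]
      _ ≤ (a + b) * ∑ j, ‖q j‖ ^ 2 := sum_norm_sq_diag_le ha hs hab hα hV
      _ ≤ M ^ 2 * ∑ j, ‖q j‖ ^ 2 := mul_le_mul_of_nonneg_right haM hs

end Diagonal

end OpSp

theorem mainTheorem3_general {α β : ℕ → unitInterval} (hα : Antitone α) (hβ : Antitone β)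
    {C D : ℝ≥0} {u : Xd α →ₗ[ℂ] Xd β} {v : Xd β →ₗ[ℂ] Xd α} (huv : u ∘ₗ v = LinearMap.id)
    (hu : cbNorm u ≤ C) (hv : cbNorm v ≤ D) :
    cbNorm (formalId α β : Xd α →ₗ[ℂ] Xd β) ≤ (NNReal.sqrt 2 * (C * D) : ℝ≥0) := by
  have hCD : 1 ≤ C * D := one_le_mul_of_cbNorm_le (norm_diag_le α) (norm_diag_le β) huv hu hv
  refine cbNorm_formalId_le (sq_nonneg (C * D : ℝ)) ?_ ?_ (sum_max_sq_sub_le hα hβ huv hu hv)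
  · exact one_le_mul (NNReal.one_le_sqrt.2 one_le_two) hCD
  · rw [← two_mul, NNReal.coe_mul, mul_pow (NNReal.sqrt 2 : ℝ), Real.coe_sqrt, NNReal.coe_ofNat,
      Real.sq_sqrt zero_le_two, NNReal.coe_mul]

theorem mainTheorem3 (α β : ℕ → unitInterval) (hα : α ∈ seqS) (hβ : β ∈ seqS) (C : ℝ≥0)
    (U : Xd α ≃ₗ[ℂ] Xd β)
    (hU : cbNorm (U : Xd α →ₗ[ℂ] Xd β) ≤ C)
    (hU' : cbNorm (U.symm : Xd β →ₗ[ℂ] Xd α) ≤ C) :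
    cbNorm (formalId α β : Xd α →ₗ[ℂ] Xd β) < 4 * (C : ℝ≥0∞) ^ 2 ∧
      cbNorm ((formalId α β).symm : Xd β →ₗ[ℂ] Xd α) < 4 * (C : ℝ≥0∞) ^ 2 := by
  have hC : 1 ≤ C * C :=
    one_le_mul_of_cbNorm_le (norm_diag_le α) (norm_diag_le β) U.comp_symm hU hU'
  have sqrt_two_lt : NNReal.sqrt 2 < 4 :=
    (NNReal.sqrt_le_iff_le_sq.2 (by norm_num : (2 : ℝ≥0) ≤ 2 ^ 2)).trans_lt (by norm_num)
  have const_lt : ((NNReal.sqrt 2 * (C * C) : ℝ≥0) : ℝ≥0∞) < 4 * (C : ℝ≥0∞) ^ 2 := by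
    rw [sq]
    norm_cast
    gcongr
  exact ⟨(mainTheorem3_general hα.1 hβ.1 U.comp_symm hU hU').trans_lt const_lt,
    (mainTheorem3_general hβ.1 hα.1 U.symm_comp hU' hU).trans_lt const_lt⟩
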